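/- A \emph{left quasigroup} is a non-empty set $X$ with a binary operation $\cdot$ such that $\sigma_x:y\mapsto x\cdot y$ is bijective for every $x\in X$. It is \emph{latin} if $y\mapsto y\cdot x$ is also bijective for every $x\in X$; it is a \emph{cycle set} if $(x\cdot y)\cdot(x\cdot z)=(y\cdot x)\cdot(y\cdot z)$ for all $x,y,z\in X$; it is \emph{simple} if the group of permutations generated by all $\sigma_x$ is transitive on $X$ and the only equivalence relations $\sim$ on $X$ such that $x\sim x'$, $y\sim y'$ imply $x\cdot y\sim x'\cdot y'$ and $\sigma_x^{-1}(y)\sim\sigma_{x'}^{-1}(y')$ are equality and the full relation. For an abelian group $(G,+)$, $\phi\in\mathrm{End}(G,+)$, $\psi\in\mathrm{Aut}(G,+)$ and $c\in G$, let $\mathrm{Aff}(G,\phi,\psi,c)$ be the set $G$ with $x\cdot y=\phi(x)+\psi(y)+c$; a left quasigroup is \emph{affine} if it is of this form for some abelian group structure on its underlying set. Let $p$ be a prime and $\mathbb{Z}_p=\mathbb{Z}/p\mathbb{Z}$. Let $\Delta$ be the $p\times p$ matrix over $\mathbb{Z}_p$ with entry $p-i$ at position $(i,i+1)$ for $1\le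 i\le p-1$ and all other entries $0$. For $\mu\in\mathbb{Z}_p$ let $A_\mu$ be the $p\times p$ matrix with entries $1$ at the positions $(i+1,i)$, $1\le i\le p-1$, entry $\mu$ at the position $(1,p)$, and all other entries $0$. Matrices act on column vectors. \textbf{Theorem.} For all $\lambda,\mu\in\{1,\ldots,p-1\}$, $$\mathrm{Aff}(\mathbb{Z}_p^p,(\lambda I+\Delta)^{-1},A_\mu,(0,\ldots,0))\quad\text{and}\quad\mathrm{Aff}(\mathbb{Z}_p^p,(\lambda I+\Delta)^{-1},A_1,(1,0,\ldots,0))$$ are affine simple latin cycle sets (of size $p^p$), and every affine simple latin cycle set of size $p^p$ is isomorphic to one of them. There are exactly $p(p-1)$ isomorphism classes of affine simple latin cycle sets of size $p^p$. -/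

import Mathlib

universe u v w

namespace CycleSets

section LeftQuasigroups

variable {X : Type u} {Y : Type v} {Z : Type w}

/-- A binary operation on a nonempty set is a left quasigroup if every left multiplication
`σ_x : y ↦ x · y` is bijective. -/
structure IsLeftQuasigroup (op : X → X → X) : Prop where
  nonempty : Nonempty X
  bijective_left : ∀ x, Function.Bijective (op x)

/-- Cycle sets: left quasigroups with `(x · y) · (x · z) = (y · x) · (y · z)`. -/
structure IsCycleSet (op : X → X → X) : Prop extends IsLeftQuasigroup op where
  cycle : ∀ x y z, op (op x y) (op x z) = op (op y x) (op y z)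

/-- Every right multiplication `δ_x : y ↦ y · x` is bijective. -/
def IsLatin (op : X → X → X) : Prop :=
  ∀ x, Function.Bijective fun y => op y x

/-- The associated permutation group, generated by all left multiplications `σ_x`. -/
def permGroup (op : X → X → X) : Subgroup (Equiv.Perm X) :=
  Subgroup.closure {g | ∃ x, ⇑g = op x}

/-- The associated permutation group acts transitively. -/
def IsIndecomposable (op : X → X → X) : Prop :=
  ∀ x y, ∃ g ∈ permGroup op, g x = y

/-- Congruences of a left quasigroup: equivalence relations compatible with the multiplication
and with the left division. As the left multiplications are bijective, compatibility with left
division is stated for elements written as `x · y` and `x' · y'`. -/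
structure IsCongruence (op : X → X → X) (r : Setoid X) : Prop where
  mul : ∀ x x' y y', r x x' → r y y' → r (op x y) (op x' y')
  ldiv : ∀ x x' y y', r x x' → r (op x y) (op x' y') → r y y'

/-- Simple left quasigroups: indecomposable, and the only congruences are equality and the
full relation. -/
structure IsSimple (op : X → X → X) : Prop where
  indecomposable : IsIndecomposable op
  eq_bot_or_eq_top : ∀ r : Setoid X, IsCongruence op r → r = ⊥ ∨ r = ⊤

/-- There is a bijective homomorphism between the two structures. -/
def Isomorphic (op : X → X → X) (op' : Y → Y → Y) : Prop :=
  ∃ e : X ≃ Y, ∀ x y, e (op x y) = op' (e x) (e y)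

theorem Isomorphic.refl (op : X → X → X) : Isomorphic op op :=
  ⟨Equiv.refl X, fun _ _ => rfl⟩

theorem Isomorphic.symm {op : X → X → X} {op' : Y → Y → Y} (h : Isomorphic op op') :
    Isomorphic op' op := by
  obtain ⟨e, he⟩ := h
  exact ⟨e.symm, fun x y => by simp [Equiv.symm_apply_eq, he]⟩

theorem Isomorphic.trans {op : X → X → X} {op' : Y → Y → Y} {op'' : Z → Z → Z}
    (h : Isomorphic op op') (h' : Isomorphic op' op'') : Isomorphic op op'' := by
  obtain ⟨e, he⟩ := h
  obtain ⟨f, hf⟩ := h'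
  exact ⟨e.trans f, fun x y => by simp [he, hf]⟩

end LeftQuasigroups

section Affine

/-- The operation `x · y = φ(x) + ψ(y) + c` of `Aff(G, φ, ψ, c)`. -/
def affOp {G : Type u} [AddCommGroup G] (φ ψ : G →+ G) (c : G) : G → G → G :=
  fun x y => φ x + ψ y + c

/-- The operation is that of `Aff(G, φ, ψ, c)` for some abelian group structure `G` on the
underlying set, an endomorphism `φ`, an automorphism `ψ` and a constant `c`. -/
def IsAffine {X : Type u} (op : X → X → X) : Prop :=
  ∃ (_ : AddCommGroup X) (φ : X →+ X) (ψ : X ≃+ X) (c : X), op = affOp φ ψ.toAddMonoidHom c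

/-- Affine simple latin cycle sets. -/
structure IsAffineSimpleLatinCycleSet {X : Type u} (op : X → X → X) : Prop where
  isCycleSet : IsCycleSet op
  isLatin : IsLatin op
  isSimple : IsSimple op
  isAffine : IsAffine op

/-- The affine simple latin cycle sets of size `n`. -/
structure AffineSimpleLatinCycleSet (n : ℕ) where
  carrier : Type u
  op : carrier → carrier → carrier
  prop : IsAffineSimpleLatinCycleSet op
  card_eq : Nat.card carrier = n

/-- Isomorphism of affine simple latin cycle sets of size `n`. -/
def isoSetoid (n : ℕ) : Setoid (AffineSimpleLatinCycleSet.{u} n) where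
  r A B := Isomorphic A.op B.op
  iseqv := ⟨fun A => Isomorphic.refl A.op, Isomorphic.symm, Isomorphic.trans⟩

end Affine

section Models

/-- The `n × n` matrix with entry `n - i` at `(i, i + 1 mod n)` and `0` elsewhere, for indices
`i = 1, …, n`; an element `i` of `Fin n` stands for the index `i + 1`. -/
def Delta (K : Type u) [CommRing K] (n : ℕ) : Matrix (Fin n) (Fin n) K :=
  Matrix.of fun i j =>
    if (j : ℕ) = ((i : ℕ) + 1) % n then (n : K) - (((i : ℕ) + 1 : ℕ) : K) else 0

/-- The `n × n` matrix `A_μ` with entries `1` just below the diagonal, `μ` in the upper right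
corner and `0` elsewhere. -/
def AMat {K : Type u} [CommRing K] (n : ℕ) (μ : K) : Matrix (Fin n) (Fin n) K :=
  Matrix.of fun i j =>
    if (i : ℕ) = (j : ℕ) + 1 then 1
    else if (i : ℕ) = 0 ∧ (j : ℕ) + 1 = n then μ
    else 0

/-- The vector `(1, 0, …, 0)`. -/
def firstVec (K : Type u) [CommRing K] (n : ℕ) : Fin n → K :=
  fun i => if (i : ℕ) = 0 then 1 else 0

/-- The operation of `Aff((ℤ/p)^p, (λ I + Δ)⁻¹, A_μ, c)`; matrices act on column vectors. -/
noncomputable def modelOp (p : ℕ) (l μ : ZMod p) (c : Fin p → ZMod p) :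
    (Fin p → ZMod p) → (Fin p → ZMod p) → (Fin p → ZMod p) :=
  affOp
    (Matrix.mulVecLin (l • (1 : Matrix (Fin p) (Fin p) (ZMod p)) + Delta (ZMod p) p)⁻¹).toAddMonoidHom
    (Matrix.mulVecLin (AMat p μ)).toAddMonoidHom
    c

end Models

end CycleSets

/-!
For an affine left quasigroup `x · y = φ x + ψ y + c` with `φ` bijective, the cycle set identity
says that `ψ φ⁻¹ - φ⁻¹ ψ = 1` (`commutator_eq_one_of_relation`), so affine latin cycle sets are
representations of the Weyl algebra by invertible operators `P = ψ` and `Q = φ⁻¹`, together with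
a constant. Their congruences are the coset partitions of invariant subgroups. Therefore
simplicity forces `p G = 0` when `G` has order `p ^ p`, and `G` has dimension `p` over `𝔽_p`.

In characteristic `p` the trace of `P Q - Q P = 1` shows that `p` divides the dimension of every
finite-dimensional representation. A representation of dimension `p` is thus irreducible
(`eq_bot_or_eq_top_of_commutator_eq_one`), which gives the simplicity of the models. By Schur's
lemma, applied over the algebraic closure, the central elements `P ^ p` and `Q ^ p` act as scalars
of `𝔽_p`. Hence `Q` has an eigenvector `v`, and in the basis `v, P v, …, P ^ (p - 1) v` the
operators `P` and `Q` have the matrices `A_μ` and `λ I + Δ` (`exists_equiv_model`).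

Conjugation by a translation changes the constant `c` by an element of the image of `1 - φ - ψ`.
If `w = φ w + ψ w`, then `ψ` fixes `φ⁻¹ w`; as `ψ ^ p = μ`, the map `1 - φ - ψ` is invertible for
`μ ≠ 1`, and for `μ = 1` its kernel has dimension at most one. In the latter case its image is the
kernel of an explicit functional that does not vanish at `(1, 0, …, 0)` (`range_modelShift_one`),
so a homothety reduces the constant to `0` or `(1, 0, …, 0)`.

Isomorphisms of affine quasigroups are affine maps (`Isomorphic.exists_addEquiv`), so they
preserve the scalars `λ = Q ^ p` and `μ = P ^ p`. The two possible constants are told apart by the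
existence of an idempotent. This leaves `(p - 1) ^ 2 + (p - 1) = p (p - 1)` classes.
-/

namespace CycleSets

/-! ### Weyl pairs in characteristic `p` -/

section WeylPairs

theorem pow_succ_mul_of_commutator_eq_one {R : Type*} [Ring R] {P Q : R}
    (h : P * Q - Q * P = 1) (n : ℕ) :
    P ^ (n + 1) * Q = Q * P ^ (n + 1) + ((n : R) + 1) * P ^ n := by
  have h' : P * Q = Q * P + 1 := by rw [← h]; abel
  induction n with
  | zero => simp [h']
  | succ n ih =>
    have hc : P * ((n : R) + 1) = ((n : R) + 1) * P :=
      ((Nat.cast_commute n P).add_left (Commute.one_left P)).symm.eq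
    calc P ^ (n + 1 + 1) * Q = P * (P ^ (n + 1) * Q) := by rw [pow_succ' P (n + 1), mul_assoc]
      _ = (P * Q) * P ^ (n + 1) + (P * ((n : R) + 1)) * P ^ n := by
        rw [ih]; noncomm_ring
      _ = Q * P ^ (n + 1 + 1) + (((n + 1 : ℕ) : R) + 1) * P ^ (n + 1) := by
        rw [h', hc, pow_succ' P (n + 1), pow_succ' P n]
        push_cast
        noncomm_ring

theorem commute_pow_left_of_commutator_eq_one {R : Type*} [Ring R] {P Q : R}
    (h : P * Q - Q * P = 1) {p : ℕ} (hp : p ≠ 0) (hR : (p : R) = 0) : Commute (P ^ p) Q := by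
  obtain ⟨n, rfl⟩ := Nat.exists_eq_succ_of_ne_zero hp
  have := pow_succ_mul_of_commutator_eq_one h n
  have h0 : (n : R) + 1 = 0 := by exact_mod_cast hR
  rw [h0, zero_mul, add_zero] at this
  exact this

theorem commute_pow_right_of_commutator_eq_one {R : Type*} [Ring R] {P Q : R}
    (h : P * Q - Q * P = 1) {p : ℕ} (hp : p ≠ 0) (hR : (p : R) = 0) : Commute P (Q ^ p) := by
  have h' : Q * (-P) - (-P) * Q = 1 := by rw [← h]; noncomm_ring
  exact (Commute.neg_right_iff.1 (commute_pow_left_of_commutator_eq_one h' hp hR)).symm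

variable {K : Type u} [Field K] {V : Type v} [AddCommGroup V] [Module K V]

/-- The trace of `P * Q - Q * P = 1` is both `0` and the dimension. -/
theorem dvd_finrank_of_commutator_eq_one [FiniteDimensional K V] (p : ℕ) [CharP K p]
    {P Q : Module.End K V} (h : P * Q - Q * P = 1) : p ∣ Module.finrank K V := by
  have := congrArg (LinearMap.trace K V) h
  rw [map_sub, LinearMap.trace_mul_comm, sub_self, LinearMap.trace_one] at this
  exact (CharP.cast_eq_zero_iff K p _).1 this.symm

/-- In dimension `p` a Weyl pair acts irreducibly, because it restricts to a Weyl pair on every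
invariant subspace. -/
theorem eq_bot_or_eq_top_of_commutator_eq_one [FiniteDimensional K V] {p : ℕ} [CharP K p]
    (hV : Module.finrank K V = p) {P Q : Module.End K V} (h : P * Q - Q * P = 1)
    (H : Submodule K V) (hP : ∀ x ∈ H, P x ∈ H) (hQ : ∀ x ∈ H, Q x ∈ H) : H = ⊥ ∨ H = ⊤ := by
  have hH : P.restrict hP * Q.restrict hQ - Q.restrict hQ * P.restrict hP = 1 := by
    ext x
    simpa using congrArg (fun f : Module.End K V => f x) h
  have hd := dvd_finrank_of_commutator_eq_one p hH
  rcases Nat.eq_zero_or_pos (Module.finrank K H) with h0 | h0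
  · exact Or.inl (Submodule.finrank_eq_zero.1 h0)
  · refine Or.inr (Submodule.eq_top_of_finrank_eq (le_antisymm (Submodule.finrank_le H) ?_))
    rw [hV]
    exact Nat.le_of_dvd h0 hd

theorem exists_eq_smul_one_of_isAlgClosed [IsAlgClosed K] [FiniteDimensional K V] {p : ℕ}
    [Fact p.Prime] [CharP K p] (hV : Module.finrank K V = p) {P Q T : Module.End K V}
    (h : P * Q - Q * P = 1) (hP : Commute P T) (hQ : Commute Q T) : ∃ a : K, T = a • 1 := by
  have : Nontrivial V := Module.nontrivial_of_finrank_pos (R := K)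
    (hV ▸ (Fact.out : p.Prime).pos)
  obtain ⟨a, ha⟩ := Module.End.exists_eigenvalue T
  refine ⟨a, ?_⟩
  have key : ∀ S : Module.End K V, Commute S T → ∀ x ∈ T.eigenspace a, S x ∈ T.eigenspace a := by
    intro S hS x hx
    rw [Module.End.mem_eigenspace_iff] at hx ⊢
    have := congrArg (fun f : Module.End K V => f x) hS.eq
    simp only [Module.End.mul_apply] at this
    rw [← this, hx, map_smul]
  rcases eq_bot_or_eq_top_of_commutator_eq_one hV h _ (key P hP) (key Q hQ) with h0 | h0
  · exact absurd h0 ha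
  · ext x
    have : x ∈ T.eigenspace a := h0 ▸ Submodule.mem_top
    simpa using Module.End.mem_eigenspace_iff.1 this

/-- Schur's lemma for Weyl pairs in dimension `p`, over a field that need not be algebraically
closed: an endomorphism that becomes a scalar over the algebraic closure is a scalar. -/
theorem exists_eq_smul_one_of_commute [FiniteDimensional K V] {p : ℕ}
    [Fact p.Prime] [CharP K p] (hV : Module.finrank K V = p) {P Q T : Module.End K V}
    (h : P * Q - Q * P = 1) (hP : Commute P T) (hQ : Commute Q T) : ∃ a : K, T = a • 1 := by
  let L := AlgebraicClosure K
  let b := Module.finBasisOfFinrankEq K V hV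
  -- Passing to matrices over the algebraic closure is a ring homomorphism.
  let F : Module.End K V →+* Module.End L (Fin p → L) :=
    ((Matrix.toLinAlgEquiv' (R := L) (n := Fin p)).toRingEquiv.toRingHom.comp
      (algebraMap K L).mapMatrix).comp
        (LinearMap.toMatrixAlgEquiv b).toRingEquiv.toRingHom
  have : CharP L p := charP_of_injective_algebraMap (algebraMap K L).injective p
  obtain ⟨a, ha⟩ := exists_eq_smul_one_of_isAlgClosed (K := L) (V := Fin p → L) (p := p)
    (by simp) (P := F P) (Q := F Q) (T := F T)
    (by rw [← map_mul, ← map_mul, ← map_sub, h, map_one]) (hP.map F) (hQ.map F)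
  have hent : ∀ i j, algebraMap K L (LinearMap.toMatrixAlgEquiv b T i j) =
      if i = j then a else 0 := by
    intro i j
    have h1 := congrFun (congrArg (fun f : Module.End L (Fin p → L) => f (Pi.single j 1)) ha) i
    have h2 : F T (Pi.single j 1) i = algebraMap K L (LinearMap.toMatrixAlgEquiv b T i j) := by
      simp [F, Matrix.toLinAlgEquiv'_apply]
    rw [← h2]
    simpa [Pi.single_apply] using h1
  let i₀ : Fin p := ⟨0, (Fact.out : p.Prime).pos⟩
  refine ⟨LinearMap.toMatrixAlgEquiv b T i₀ i₀, ?_⟩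
  apply (LinearMap.toMatrixAlgEquiv b).injective
  ext i j
  apply (algebraMap K L).injective
  rw [hent, map_smul, map_one, Matrix.smul_apply, Matrix.one_apply, smul_eq_mul, map_mul, hent]
  by_cases hij : i = j <;> simp [hij]

theorem natCast_end_eq_zero (p : ℕ) [CharP K p] : ((p : ℕ) : Module.End K V) = 0 := by
  rw [← map_natCast (algebraMap K (Module.End K V)), CharP.cast_eq_zero, map_zero]

theorem exists_pow_left_eq_smul_one [FiniteDimensional K V] {p : ℕ}
    [Fact p.Prime] [CharP K p] (hV : Module.finrank K V = p) {P Q : Module.End K V}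
    (h : P * Q - Q * P = 1) : ∃ a : K, P ^ p = a • 1 :=
  exists_eq_smul_one_of_commute hV h ((Commute.refl P).pow_right p)
    (commute_pow_left_of_commutator_eq_one h (Fact.out : p.Prime).ne_zero
      (natCast_end_eq_zero p)).symm

theorem exists_pow_right_eq_smul_one [FiniteDimensional K V] {p : ℕ}
    [Fact p.Prime] [CharP K p] (hV : Module.finrank K V = p) {P Q : Module.End K V}
    (h : P * Q - Q * P = 1) : ∃ a : K, Q ^ p = a • 1 :=
  exists_eq_smul_one_of_commute hV h
    (commute_pow_right_of_commutator_eq_one h (Fact.out : p.Prime).ne_zero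
      (natCast_end_eq_zero p)) ((Commute.refl Q).pow_right p)

/-- The `p`-th power of `Q` is a scalar `a = a ^ p`, so `Q - a` is nilpotent. -/
theorem exists_eigenvector_right {p : ℕ} [Fact p.Prime] {V : Type v} [AddCommGroup V]
    [Module (ZMod p) V] [FiniteDimensional (ZMod p) V] (hV : Module.finrank (ZMod p) V = p)
    {P Q : Module.End (ZMod p) V} (h : P * Q - Q * P = 1) :
    ∃ (l : ZMod p) (v : V), v ≠ 0 ∧ Q v = l • v := by
  have : Nontrivial V := Module.nontrivial_of_finrank_pos (R := ZMod p)
    (by rw [hV]; exact (Fact.out : p.Prime).pos)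
  obtain ⟨l, hl⟩ := exists_pow_right_eq_smul_one hV h
  have : CharP (Module.End (ZMod p) V) p :=
    charP_of_injective_algebraMap (algebraMap (ZMod p) (Module.End (ZMod p) V)).injective p
  have hcomm : Commute Q (algebraMap (ZMod p) (Module.End (ZMod p) V) l) :=
    (Algebra.commutes l Q).symm
  have hnil : (Q - algebraMap (ZMod p) (Module.End (ZMod p) V) l) ^ p = 0 := by
    rw [sub_pow_char_of_commute _ hcomm, hl, ← map_pow, ZMod.pow_card,
      Algebra.algebraMap_eq_smul_one, sub_self]
  by_contra! hne
  have hinj : Function.Injective (Q - algebraMap (ZMod p) (Module.End (ZMod p) V) l) := by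
    rw [injective_iff_map_eq_zero]
    intro v hv
    by_contra hv0
    refine hne l v hv0 ?_
    simpa [sub_eq_zero, Module.algebraMap_end_apply] using hv
  have hinj' := hinj.iterate p
  rw [← Module.End.coe_pow, hnil] at hinj'
  obtain ⟨v, hv⟩ := exists_ne (0 : V)
  exact hv (hinj' (by simp))

end WeylPairs

/-! ### The model Weyl pairs -/

section ModelPairs

/-- The vector with entry `1` at position `k` (counted from `0`) and `0` elsewhere; it is `0` when
`n ≤ k`. -/
def stdVec (K : Type u) [CommRing K] (n k : ℕ) : Fin n → K :=
  fun i => if (i : ℕ) = k then 1 else 0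

theorem stdVec_eq_single {K : Type u} [CommRing K] {n : ℕ} (i : Fin n) :
    stdVec K n i = Pi.single i 1 := by
  ext j
  simp [stdVec, Pi.single_apply, Fin.ext_iff]

theorem stdVec_ne_zero {K : Type u} [CommRing K] [Nontrivial K] {n k : ℕ} (hk : k < n) :
    stdVec K n k ≠ 0 := fun h => by
  simpa [stdVec] using congrFun h ⟨k, hk⟩

theorem linearMap_ext_stdVec {K : Type u} [CommRing K] {n : ℕ} {M : Type v} [AddCommGroup M]
    [Module K M] {f g : (Fin n → K) →ₗ[K] M} (h : ∀ k < n, f (stdVec K n k) = g (stdVec K n k)) :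
    f = g :=
  (Pi.basisFun K (Fin n)).ext fun i => by
    simpa [stdVec_eq_single] using h i i.2

/-- The linear map that sends the `k`-th standard basis vector to `f k`. -/
def stdLift (K : Type u) [CommRing K] (n : ℕ) {M : Type v} [AddCommGroup M] [Module K M]
    (f : ℕ → M) : (Fin n → K) →ₗ[K] M :=
  Fintype.linearCombination K fun i : Fin n => f i

theorem stdLift_stdVec {K : Type u} [CommRing K] {n : ℕ} {M : Type v} [AddCommGroup M]
    [Module K M] (f : ℕ → M) {k : ℕ} (hk : k < n) : stdLift K n f (stdVec K n k) = f k := by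
  have := stdVec_eq_single (K := K) (⟨k, hk⟩ : Fin n)
  simp only at this
  rw [this]
  simp [stdLift, Fintype.linearCombination_apply_single]

/-- The linear map of the matrix `A_μ`. -/
noncomputable def modelP (p : ℕ) (m : ZMod p) : Module.End (ZMod p) (Fin p → ZMod p) :=
  Matrix.mulVecLin (AMat p m)

/-- The linear map of the matrix `λ I + Δ`. -/
noncomputable def modelQ (p : ℕ) (l : ZMod p) : Module.End (ZMod p) (Fin p → ZMod p) :=
  Matrix.mulVecLin (l • (1 : Matrix (Fin p) (Fin p) (ZMod p)) + Delta (ZMod p) p)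

variable {p : ℕ}

theorem mulVec_stdVec (M : Matrix (Fin p) (Fin p) (ZMod p)) {k : ℕ} (hk : k < p) (i : Fin p) :
    M.mulVec (stdVec (ZMod p) p k) i = M i ⟨k, hk⟩ := by
  have := stdVec_eq_single (K := ZMod p) (⟨k, hk⟩ : Fin p)
  simp only at this
  simp [this]

theorem modelP_stdVec (m : ZMod p) {k : ℕ} (hk : k + 1 < p) :
    modelP p m (stdVec (ZMod p) p k) = stdVec (ZMod p) p (k + 1) := by
  ext i
  rw [modelP, Matrix.mulVecLin_apply, mulVec_stdVec _ (by omega)]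
  have : k + 1 ≠ p := by omega
  simp [AMat, stdVec, this]

theorem modelP_stdVec_last (m : ZMod p) {k : ℕ} (hk : k + 1 = p) :
    modelP p m (stdVec (ZMod p) p k) = m • stdVec (ZMod p) p 0 := by
  ext i
  have : (i : ℕ) ≠ p := i.2.ne
  rw [modelP, Matrix.mulVecLin_apply, mulVec_stdVec _ (by omega)]
  simp [AMat, stdVec, this, hk]

theorem modelQ_stdVec_zero (l : ZMod p) :
    modelQ p l (stdVec (ZMod p) p 0) = l • stdVec (ZMod p) p 0 := by
  ext i
  rw [modelQ, Matrix.mulVecLin_apply, mulVec_stdVec _ i.pos]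
  have hD : Delta (ZMod p) p i ⟨0, i.pos⟩ = 0 := by
    simp only [Delta, Matrix.of_apply]
    split_ifs with h
    · have h' : (((i : ℕ) + 1 : ℕ) : ZMod p) = 0 :=
        (ZMod.natCast_eq_zero_iff _ _).2 (Nat.dvd_of_mod_eq_zero h.symm)
      rw [h', ZMod.natCast_self, sub_zero]
    · rfl
  rw [Matrix.add_apply, hD]
  simp [Matrix.one_apply, stdVec, Fin.ext_iff]

theorem modelQ_stdVec_succ (l : ZMod p) {k : ℕ} (hk : k < p) :
    modelQ p l (stdVec (ZMod p) p (k + 1)) =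
      l • stdVec (ZMod p) p (k + 1) - ((k : ZMod p) + 1) • stdVec (ZMod p) p k := by
  rcases Nat.lt_or_ge (k + 1) p with hk' | hk'
  · ext i
    have h : k + 1 = ((i : ℕ) + 1) % p ↔ (i : ℕ) = k := by
      rcases Nat.lt_or_ge ((i : ℕ) + 1) p with hi | hi
      · rw [Nat.mod_eq_of_lt hi]; omega
      · have : (i : ℕ) + 1 = p := by omega
        rw [this, Nat.mod_self]; omega
    have hD : Delta (ZMod p) p i ⟨k + 1, hk'⟩ = if (i : ℕ) = k then -((k : ZMod p) + 1) else 0 := by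
      simp only [Delta, Matrix.of_apply, h]
      split_ifs with hi
      · rw [hi]; simp
      · rfl
    rw [modelQ, Matrix.mulVecLin_apply, mulVec_stdVec _ hk', Matrix.add_apply, hD]
    by_cases h1 : (i : ℕ) = k
    · simp [stdVec, Fin.ext_iff, h1]
    · simp [Matrix.one_apply, stdVec, Fin.ext_iff, h1]
  · -- Here `k + 1 = p`, and both sides vanish.
    have hkp : k + 1 = p := by omega
    have h0 : stdVec (ZMod p) p (k + 1) = 0 := by
      ext i
      have : (i : ℕ) ≠ k + 1 := by omega
      simp [stdVec, this]
    have h1 : (k : ZMod p) + 1 = 0 := by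
      have : ((k + 1 : ℕ) : ZMod p) = 0 := by rw [hkp]; simp
      exact_mod_cast this
    simp [h0, h1]

theorem modelP_mul_modelQ_sub [Fact p.Prime] (l m : ZMod p) :
    modelP p m * modelQ p l - modelQ p l * modelP p m = 1 := by
  have hp := (Fact.out : p.Prime).two_le
  apply linearMap_ext_stdVec
  intro k hk
  simp only [LinearMap.sub_apply, Module.End.mul_apply, Module.End.one_apply]
  cases k with
  | zero =>
    rw [modelQ_stdVec_zero, map_smul, modelP_stdVec m (by omega), modelQ_stdVec_succ l (by omega)]
    simp
  | succ k =>
    rw [modelQ_stdVec_succ l (by omega), map_sub, map_smul, map_smul, modelP_stdVec m hk]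
    rcases Nat.lt_or_ge (k + 1 + 1) p with hk' | hk'
    · rw [modelP_stdVec m hk', modelQ_stdVec_succ l hk]
      push_cast
      module
    · have hkp : k + 1 + 1 = p := by omega
      have h1 : (k : ZMod p) + 1 = -1 := by
        have : ((k + 1 + 1 : ℕ) : ZMod p) = 0 := by rw [hkp]; simp
        push_cast at this
        linear_combination this
      rw [modelP_stdVec_last m hkp, map_smul, modelQ_stdVec_zero, h1]
      module

theorem modelP_pow_stdVec_zero (m : ZMod p) {k : ℕ} (hk : k < p) :
    (modelP p m ^ k) (stdVec (ZMod p) p 0) = stdVec (ZMod p) p k := by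
  induction k with
  | zero => simp
  | succ k ih => rw [pow_succ', Module.End.mul_apply, ih (by omega), modelP_stdVec m hk]

theorem modelP_pow [Fact p.Prime] (m : ZMod p) : modelP p m ^ p = m • 1 := by
  obtain ⟨a, ha⟩ := exists_pow_left_eq_smul_one (by simp) (modelP_mul_modelQ_sub (0 : ZMod p) m)
  have hp := (Fact.out : p.Prime).pos
  have h1 : (modelP p m ^ (p - 1 + 1)) (stdVec (ZMod p) p 0) = m • stdVec (ZMod p) p 0 := by
    rw [pow_succ', Module.End.mul_apply, modelP_pow_stdVec_zero m (by omega),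
      modelP_stdVec_last m (by omega)]
  rw [Nat.sub_add_cancel hp, ha] at h1
  have := smul_left_injective (ZMod p) (stdVec_ne_zero (K := ZMod p) hp) h1
  rw [ha, this]

theorem modelQ_pow [Fact p.Prime] (l : ZMod p) : modelQ p l ^ p = l • 1 := by
  obtain ⟨a, ha⟩ := exists_pow_right_eq_smul_one (by simp) (modelP_mul_modelQ_sub l (0 : ZMod p))
  have hp := (Fact.out : p.Prime).pos
  have h1 : ∀ k, (modelQ p l ^ k) (stdVec (ZMod p) p 0) = l ^ k • stdVec (ZMod p) p 0 := by
    intro k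
    induction k with
    | zero => simp
    | succ k ih =>
      rw [pow_succ', Module.End.mul_apply, ih, map_smul, modelQ_stdVec_zero, smul_smul, pow_succ]
  have h2 := h1 p
  rw [ha, ZMod.pow_card] at h2
  have := smul_left_injective (ZMod p) (stdVec_ne_zero (K := ZMod p) hp) h2
  rw [ha, this]

theorem bijective_of_pow_eq_smul_one {K : Type*} [Field K] {V : Type*} [AddCommGroup V]
    [Module K V] {T : Module.End K V} {a : K} (ha : a ≠ 0) {n : ℕ} (hn : n ≠ 0)
    (h : T ^ n = a • 1) : Function.Bijective T := by
  have hu : IsUnit (T ^ n) := by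
    rw [h, ← Algebra.algebraMap_eq_smul_one]
    exact (IsUnit.mk0 a ha).map _
  exact (Module.End.isUnit_iff T).1 ((isUnit_pow_iff hn).1 hu)

theorem bijective_modelP [Fact p.Prime] {m : ZMod p} (hm : m ≠ 0) :
    Function.Bijective (modelP p m) :=
  bijective_of_pow_eq_smul_one hm (Fact.out : p.Prime).ne_zero (modelP_pow m)

theorem bijective_modelQ [Fact p.Prime] {l : ZMod p} (hl : l ≠ 0) :
    Function.Bijective (modelQ p l) :=
  bijective_of_pow_eq_smul_one hl (Fact.out : p.Prime).ne_zero (modelQ_pow l)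

/-- Classification of Weyl pairs in dimension `p`. The `P ^ i v`, for an eigenvector `v` of `Q`,
are transformed by `P` and `Q` as the standard basis is by the model; the resulting intertwining
map has an invariant kernel, hence it is injective. -/
theorem exists_equiv_model [Fact p.Prime] {V : Type v} [AddCommGroup V] [Module (ZMod p) V]
    [FiniteDimensional (ZMod p) V] (hV : Module.finrank (ZMod p) V = p)
    {P Q : Module.End (ZMod p) V} (h : P * Q - Q * P = 1) :
    ∃ (l m : ZMod p) (S : (Fin p → ZMod p) ≃ₗ[ZMod p] V),
      (∀ x, S (modelP p m x) = P (S x)) ∧ ∀ x, S (modelQ p l x) = Q (S x) := by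
  have hp := (Fact.out : p.Prime).pos
  obtain ⟨m, hm⟩ := exists_pow_left_eq_smul_one hV h
  obtain ⟨l, v, hv, hlv⟩ := exists_eigenvector_right hV h
  let S : (Fin p → ZMod p) →ₗ[ZMod p] V := stdLift (ZMod p) p fun i => (P ^ i) v
  have hS : ∀ k < p, S (stdVec (ZMod p) p k) = (P ^ k) v := fun k hk => stdLift_stdVec _ hk
  have hSP : S ∘ₗ modelP p m = P ∘ₗ S := by
    apply linearMap_ext_stdVec
    intro k hk
    rw [LinearMap.comp_apply, LinearMap.comp_apply, hS k hk, ← Module.End.mul_apply, ← pow_succ']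
    rcases Nat.lt_or_ge (k + 1) p with hk' | hk'
    · rw [modelP_stdVec m hk', hS _ hk']
    · have hkp : k + 1 = p := by omega
      rw [modelP_stdVec_last m hkp, map_smul, hS 0 hp, hkp, hm]
      simp
  have hSQ : S ∘ₗ modelQ p l = Q ∘ₗ S := by
    apply linearMap_ext_stdVec
    intro k hk
    rw [LinearMap.comp_apply, LinearMap.comp_apply, hS k hk]
    cases k with
    | zero => rw [modelQ_stdVec_zero, map_smul, hS 0 hp]; simp [hlv]
    | succ k =>
      have h1 := congrArg (fun f : Module.End (ZMod p) V => f v)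
        (pow_succ_mul_of_commutator_eq_one h k)
      have h2 : ((k : Module.End (ZMod p) V) + 1) = ((k : ZMod p) + 1) • 1 := by
        rw [← Algebra.algebraMap_eq_smul_one, map_add, map_natCast, map_one]
      rw [h2] at h1
      simp only [Module.End.mul_apply, LinearMap.add_apply, hlv, map_smul, smul_mul_assoc,
        one_mul, LinearMap.smul_apply] at h1
      rw [modelQ_stdVec_succ l (by omega), map_sub, map_smul, map_smul, hS _ hk,
        hS k (by omega), h1, add_sub_cancel_right]
  have hSP' := fun x => LinearMap.congr_fun hSP x
  have hSQ' := fun x => LinearMap.congr_fun hSQ x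
  simp only [LinearMap.comp_apply] at hSP' hSQ'
  have hker : LinearMap.ker S = ⊥ := by
    refine (eq_bot_or_eq_top_of_commutator_eq_one (by simp) (modelP_mul_modelQ_sub l m)
      (LinearMap.ker S) ?_ ?_).resolve_right ?_
    · intro x hx
      rw [LinearMap.mem_ker] at hx ⊢
      rw [hSP', hx, map_zero]
    · intro x hx
      rw [LinearMap.mem_ker] at hx ⊢
      rw [hSQ', hx, map_zero]
    · intro htop
      have h0 : stdVec (ZMod p) p 0 ∈ LinearMap.ker S := htop ▸ Submodule.mem_top
      rw [LinearMap.mem_ker, hS 0 hp] at h0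
      exact hv (by simpa using h0)
  let e := LinearEquiv.ofInjectiveOfFinrankEq S (LinearMap.ker_eq_bot.1 hker) (by simp [hV])
  exact ⟨l, m, e, fun x => hSP' x, fun x => hSQ' x⟩

end ModelPairs

/-! ### Affine left quasigroups -/

section AffineLeftQuasigroups

variable {G : Type u} [AddCommGroup G] {G' : Type v} [AddCommGroup G']

theorem relation_of_cycle {φ ψ : G →+ G} {c : G}
    (h : ∀ x y z, affOp φ ψ c (affOp φ ψ c x y) (affOp φ ψ c x z) =
      affOp φ ψ c (affOp φ ψ c y x) (affOp φ ψ c y z)) (x : G) :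
    φ (φ x) + ψ (φ x) = φ (ψ x) := by
  have := h x 0 0
  simp only [affOp, map_add, map_zero, add_zero, zero_add] at this
  rw [add_right_cancel_iff, add_right_comm, ← sub_eq_zero] at this
  rw [← sub_eq_zero, ← this]
  abel

theorem isCycleSet_affOp {φ ψ : G →+ G} (hψ : Function.Bijective ψ) (c : G)
    (h : ∀ x, φ (φ x) + ψ (φ x) = φ (ψ x)) : IsCycleSet (affOp φ ψ c) where
  nonempty := ⟨0⟩
  bijective_left x := by
    have h1 : affOp φ ψ c x = (fun z => z + c) ∘ (fun z => φ x + z) ∘ ψ := rfl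
    rw [h1]
    exact (AddGroup.addRight_bijective c).comp ((AddGroup.addLeft_bijective (φ x)).comp hψ)
  cycle x y z := by
    simp only [affOp, map_add, ← h]
    abel

theorem isLatin_affOp {φ : G →+ G} (hφ : Function.Bijective φ) (ψ : G →+ G) (c : G) :
    IsLatin (affOp φ ψ c) := by
  intro x
  have h1 : (fun y => affOp φ ψ c y x) = (fun z => z + c) ∘ (fun z => z + ψ x) ∘ φ := rfl
  rw [h1]
  exact (AddGroup.addRight_bijective c).comp ((AddGroup.addRight_bijective (ψ x)).comp hφ)

theorem bijective_of_isLatin_affOp {φ ψ : G →+ G} {c : G} (h : IsLatin (affOp φ ψ c)) :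
    Function.Bijective φ := by
  have h1 : (φ : G → G) = (fun z => z + -c) ∘ fun y => affOp φ ψ c y 0 := by
    ext y
    simp [affOp]
  rw [h1]
  exact (AddGroup.addRight_bijective (-c)).comp (h 0)

theorem IsLatin.isIndecomposable {X : Type u} {op : X → X → X} (hl : IsLeftQuasigroup op)
    (h : IsLatin op) : IsIndecomposable op := by
  intro x y
  obtain ⟨z, hz⟩ := (h x).2 y
  exact ⟨Equiv.ofBijective (op z) (hl.bijective_left z),
    Subgroup.subset_closure ⟨z, rfl⟩, hz⟩

theorem IsCongruence.add_right {φ ψ : G →+ G} {c : G} (hφ : Function.Surjective φ)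
    (hψ : Function.Surjective ψ) {r : Setoid G} (hr : IsCongruence (affOp φ ψ c) r)
    {x y : G} (h : r x y) (z : G) : r (x + z) (y + z) := by
  obtain ⟨x, rfl⟩ := hψ x
  obtain ⟨y, rfl⟩ := hψ y
  obtain ⟨a, ha⟩ := hφ (-c)
  obtain ⟨b, hb⟩ := hφ (z - c)
  have h1 : r x y := hr.ldiv a a x y (r.refl a) (by
    have : ∀ w, affOp φ ψ c a w = ψ w := fun w => by simp [affOp, ha]
    rwa [this, this])
  have h2 := hr.mul b b x y (r.refl b) h1
  have : ∀ w, affOp φ ψ c b w = ψ w + z := fun w => by simp only [affOp, hb]; abel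
  rwa [this, this] at h2

/-- The congruence class of `0` is an invariant subgroup, and it determines the congruence. -/
theorem isSimple_affOp {φ ψ : G →+ G} (hφ : Function.Bijective φ) (hψ : Function.Bijective ψ)
    (c : G) (hirr : ∀ H : AddSubgroup G, (∀ x ∈ H, φ x ∈ H) → (∀ x ∈ H, ψ x ∈ H) →
      H = ⊥ ∨ H = ⊤)
    (hl : IsLeftQuasigroup (affOp φ ψ c)) : IsSimple (affOp φ ψ c) where
  indecomposable := (isLatin_affOp hφ ψ c).isIndecomposable hl
  eq_bot_or_eq_top r hr := by
    have htr : ∀ {x y : G}, r x y → ∀ z, r (x + z) (y + z) :=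
      fun h z => hr.add_right hφ.2 hψ.2 h z
    let H : AddSubgroup G :=
      { carrier := {x | r x 0}
        zero_mem' := r.refl 0
        add_mem' := fun {a b} ha hb => r.trans (by simpa using htr ha b) hb
        neg_mem' := fun {a} ha => r.symm (by simpa using htr ha (-a)) }
    have hmem : ∀ x y, r x y ↔ x - y ∈ H := by
      intro x y
      constructor
      · intro h
        have := htr h (-y)
        rwa [add_neg_cancel, ← sub_eq_add_neg] at this
      · intro h
        have := htr (show r (x - y) 0 from h) y
        rwa [sub_add_cancel, zero_add] at this
    have hH := hirr H
      (fun x hx => by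
        have := (hmem _ _).1 (hr.mul x 0 0 0 hx (r.refl 0))
        simpa [affOp] using this)
      (fun x hx => by
        have := (hmem _ _).1 (hr.mul 0 0 x 0 (r.refl 0) hx)
        simpa [affOp] using this)
    rcases hH with hH | hH
    · left
      ext x y
      rw [hmem, hH, AddSubgroup.mem_bot, sub_eq_zero]
      rfl
    · right
      ext x y
      rw [hmem, hH]
      exact ⟨fun _ => trivial, fun _ => AddSubgroup.mem_top _⟩

/-- The cosets of an invariant subgroup are the classes of a congruence. -/
theorem IsSimple.addSubgroup_eq_bot_or_eq_top {φ ψ : G →+ G} {c : G}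
    (h : IsSimple (affOp φ ψ c)) (H : AddSubgroup G) (hφ : ∀ x ∈ H, φ x ∈ H)
    (hψ : ∀ x, ψ x ∈ H ↔ x ∈ H) : H = ⊥ ∨ H = ⊤ := by
  have hdiff : ∀ x x' y y', -affOp φ ψ c x y + affOp φ ψ c x' y' =
      φ (-x + x') + ψ (-y + y') := by
    intro x x' y y'
    simp only [affOp, map_add, map_neg]
    abel
  have hr : IsCongruence (affOp φ ψ c) (QuotientAddGroup.leftRel H) := by
    constructor
    · intro x x' y y' hx hy
      rw [QuotientAddGroup.leftRel_apply] at hx hy ⊢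
      rw [hdiff]
      exact H.add_mem (hφ _ hx) ((hψ _).2 hy)
    · intro x x' y y' hx hy
      rw [QuotientAddGroup.leftRel_apply] at hx hy ⊢
      rw [hdiff] at hy
      exact (hψ _).1 ((H.add_mem_cancel_left (hφ _ hx)).1 hy)
  rcases h.eq_bot_or_eq_top _ hr with h0 | h0
  · left
    rw [eq_bot_iff]
    intro x hx
    have h1 : QuotientAddGroup.leftRel H 0 x := by
      rw [QuotientAddGroup.leftRel_apply]
      simpa using hx
    rw [h0] at h1
    exact (AddSubgroup.mem_bot).2 (show (0 : G) = x from h1).symm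
  · right
    rw [eq_top_iff]
    intro x _
    have h1 : QuotientAddGroup.leftRel H 0 x := by
      rw [h0]
      trivial
    rw [QuotientAddGroup.leftRel_apply] at h1
    simpa using h1

theorem isomorphic_affOp_of_equiv {φ ψ : G →+ G} {φ' ψ' : G' →+ G'} {c : G} {c' : G'}
    (T : G ≃+ G') (a : G') (hφ : ∀ x, T (φ x) = φ' (T x)) (hψ : ∀ x, T (ψ x) = ψ' (T x))
    (hc : T c + a = φ' a + ψ' a + c') : Isomorphic (affOp φ ψ c) (affOp φ' ψ' c') := by
  refine ⟨T.toEquiv.trans (Equiv.addRight a), fun x y => ?_⟩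
  change T (φ x + ψ y + c) + a = φ' (T x + a) + ψ' (T y + a) + c'
  rw [map_add, map_add, map_add, map_add, hφ, hψ, add_assoc _ (T c) a, hc]
  abel

/-- An isomorphism `f` of affine quasigroups satisfies `f (u + v + c) = α u + β v` for all `u` and
`v`, hence it is an affine map; `T` is its linear part. -/
theorem Isomorphic.exists_addEquiv {φ ψ : G →+ G} {φ' ψ' : G' →+ G'} {c : G} {c' : G'}
    (hφ : Function.Surjective φ) (hψ : Function.Surjective ψ)
    (h : Isomorphic (affOp φ ψ c) (affOp φ' ψ' c')) :
    ∃ T : G ≃+ G', (∀ x, T (φ x) = φ' (T x)) ∧ ∀ x, T (ψ x) = ψ' (T x) := by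
  obtain ⟨f, hf⟩ := h
  have hf' : ∀ x y, f (φ x + ψ y + c) = φ' (f x) + ψ' (f y) + c' := hf
  have hadd : ∀ u v, f (u + v + c) = f (u + c) + f (v + c) - f c := by
    intro u v
    obtain ⟨x, rfl⟩ := hφ u
    obtain ⟨y, rfl⟩ := hψ v
    have h1 := hf' x 0
    have h2 := hf' 0 y
    have h3 := hf' 0 0
    simp only [map_zero, add_zero, zero_add] at h1 h2 h3
    rw [hf', h1, h2, h3]
    abel
  let T : G ≃+ G' :=
    { toEquiv := ((Equiv.addRight c).trans f).trans (Equiv.addRight (-f c))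
      map_add' := fun u v => by
        simp only [Equiv.toFun_as_coe, Equiv.trans_apply, Equiv.coe_addRight, hadd]
        abel }
  have hT : ∀ x, T x = f (x + c) - f c := fun x => by
    rw [sub_eq_add_neg]
    rfl
  have hfT : ∀ x, f x = T x + f 0 := by
    intro x
    have h1 := hT (x - c)
    have h2 := hT (-c)
    rw [sub_add_cancel] at h1
    rw [neg_add_cancel] at h2
    have h3 : T (x - c) = T x + T (-c) := by rw [sub_eq_add_neg, map_add]
    rw [h3, h2] at h1
    have h4 : T x = f x - f 0 := by
      rw [eq_sub_iff_add_eq] at h1 ⊢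
      rw [← h1]
      abel
    rw [h4, sub_add_cancel]
  refine ⟨T, fun x => ?_, fun x => ?_⟩
  · have h1 := hf' x 0
    have h2 := hf' 0 0
    simp only [map_zero, add_zero, zero_add] at h1 h2
    rw [hT, h1, h2, hfT x, map_add]
    abel
  · have h1 := hf' 0 x
    have h2 := hf' 0 0
    simp only [map_zero, add_zero, zero_add] at h1 h2
    rw [hT, h1, h2, hfT x, map_add]
    abel

/-- The cycle set condition on `φ` and `ψ` says that `ψ` and `φ⁻¹` form a Weyl pair. -/
theorem commutator_eq_one_of_relation {K : Type*} [Field K] [Module K G] (e : G ≃ₗ[K] G)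
    (P : Module.End K G) (h : ∀ x, e (e x) + P (e x) = e (P x)) :
    P * (e.symm : Module.End K G) - (e.symm : Module.End K G) * P = 1 := by
  ext y
  obtain ⟨x, rfl⟩ := e.surjective y
  have h1 := congrArg e.symm (h x)
  rw [map_add, e.symm_apply_apply, e.symm_apply_apply] at h1
  change P (e.symm (e x)) - e.symm (P (e x)) = e x
  rw [e.symm_apply_apply, ← h1, add_sub_cancel_right]

/-- A Weyl pair in dimension `p` is irreducible, whatever the constant. -/
theorem isAffineSimpleLatinCycleSet_affOp {p : ℕ} [Fact p.Prime] [Module (ZMod p) G]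
    [FiniteDimensional (ZMod p) G] (hG : Module.finrank (ZMod p) G = p)
    {φ ψ : G →+ G} (hφ : Function.Bijective φ) (hψ : Function.Bijective ψ)
    (h : ∀ x, φ (φ x) + ψ (φ x) = φ (ψ x)) (c : G) :
    IsAffineSimpleLatinCycleSet (affOp φ ψ c) := by
  have hcs := isCycleSet_affOp hψ c h
  refine ⟨hcs, isLatin_affOp hφ ψ c, isSimple_affOp hφ hψ c ?_ hcs.toIsLeftQuasigroup,
    inferInstance, φ, AddEquiv.ofBijective ψ hψ, c, rfl⟩
  intro H hHφ hHψ
  let e := LinearEquiv.ofBijective (φ.toZModLinearMap p) hφ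
  let P : Module.End (ZMod p) G := ψ.toZModLinearMap p
  have hPQ := commutator_eq_one_of_relation e P h
  let H' : Submodule (ZMod p) G := AddSubgroup.toZModSubmodule p H
  -- A subspace that is mapped into itself by the bijection `φ` is mapped onto itself.
  have hmap : H'.map (e : G →ₗ[ZMod p] G) = H' := by
    refine Submodule.eq_of_le_of_finrank_eq ?_ (LinearEquiv.finrank_map_eq e H')
    rintro _ ⟨x, hx, rfl⟩
    exact hHφ x hx
  have hQ : ∀ x ∈ H', e.symm x ∈ H' := by
    intro x hx
    rw [← hmap] at hx
    obtain ⟨y, hy, rfl⟩ := hx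
    change e.symm (e y) ∈ H'
    rwa [e.symm_apply_apply]
  have := eq_bot_or_eq_top_of_commutator_eq_one hG hPQ H' (fun x hx => hHψ x hx) hQ
  rcases this with h0 | h0
  · left
    ext x
    have : x ∈ H' ↔ x ∈ (⊥ : Submodule (ZMod p) G) := by rw [h0]
    exact this
  · right
    ext x
    have : x ∈ H' ↔ x ∈ (⊤ : Submodule (ZMod p) G) := by rw [h0]
    exact this

/-- Multiplication by `p` commutes with every endomorphism, so its image is an invariant
subgroup. -/
theorem IsSimple.nsmul_eq_zero {p : ℕ} [Fact p.Prime] {φ ψ : G →+ G} {c : G}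
    (h : IsSimple (affOp φ ψ c)) (hψ : Function.Bijective ψ) {k : ℕ}
    (hG : Nat.card G = p ^ k) (x : G) : p • x = 0 := by
  have hp := (Fact.out : p.Prime)
  have : Finite G := Nat.finite_of_card_ne_zero (hG ▸ pow_ne_zero k hp.ne_zero)
  rcases h.addSubgroup_eq_bot_or_eq_top (nsmulAddMonoidHom p : G →+ G).range
    (by rintro _ ⟨x, rfl⟩; exact ⟨φ x, by simp⟩)
    (by
      intro x
      constructor
      · rintro ⟨y, hy⟩
        obtain ⟨z, rfl⟩ := hψ.2 y
        exact ⟨z, hψ.1 (by simpa using hy)⟩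
      · rintro ⟨y, rfl⟩
        exact ⟨ψ y, by simp⟩) with h0 | h0
  · have hx : (nsmulAddMonoidHom p : G →+ G) x ∈ (⊥ : AddSubgroup G) := h0 ▸ ⟨x, rfl⟩
    simpa using hx
  · -- Multiplication by `p` is onto, hence injective, although its `k`-th power is `0`.
    have hinj : Function.Injective (nsmulAddMonoidHom p : G →+ G) :=
      Finite.injective_iff_surjective.2 (AddMonoidHom.range_eq_top.1 h0)
    have hpow : ∀ n : ℕ, (nsmulAddMonoidHom p : G →+ G)^[n] x = p ^ n • x := by
      intro n
      induction n with
      | zero => simp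
      | succ n ih =>
        rw [Function.iterate_succ_apply', ih, nsmulAddMonoidHom_apply, smul_smul, pow_succ']
    have h1 : (nsmulAddMonoidHom p : G →+ G)^[k] x = (nsmulAddMonoidHom p : G →+ G)^[k] 0 := by
      rw [hpow, ← hG, iterate_map_zero, card_nsmul_eq_zero']
    rw [hinj.iterate k h1, smul_zero]

end AffineLeftQuasigroups

/-! ### Constants of the models -/

section ModelConstants

variable {p : ℕ}

/-- The linear map of the matrix `(λ I + Δ)⁻¹`. -/
noncomputable def modelPhi (p : ℕ) (l : ZMod p) : Module.End (ZMod p) (Fin p → ZMod p) :=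
  Matrix.mulVecLin (l • (1 : Matrix (Fin p) (Fin p) (ZMod p)) + Delta (ZMod p) p)⁻¹

theorem modelOp_eq (l m : ZMod p) (c : Fin p → ZMod p) :
    modelOp p l m c =
      affOp (modelPhi p l).toAddMonoidHom (modelP p m).toAddMonoidHom c := rfl

theorem isUnit_det_modelQ [Fact p.Prime] {l : ZMod p} (hl : l ≠ 0) :
    IsUnit (l • (1 : Matrix (Fin p) (Fin p) (ZMod p)) + Delta (ZMod p) p).det := by
  rw [← Matrix.isUnit_iff_isUnit_det, ← Matrix.mulVec_injective_iff_isUnit]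
  exact (bijective_modelQ hl).1

theorem modelQ_modelPhi [Fact p.Prime] {l : ZMod p} (hl : l ≠ 0) (x : Fin p → ZMod p) :
    modelQ p l (modelPhi p l x) = x := by
  rw [modelQ, modelPhi, Matrix.mulVecLin_apply, Matrix.mulVecLin_apply, Matrix.mulVec_mulVec,
    Matrix.mul_nonsing_inv _ (isUnit_det_modelQ hl), Matrix.one_mulVec]

theorem modelPhi_modelQ [Fact p.Prime] {l : ZMod p} (hl : l ≠ 0) (x : Fin p → ZMod p) :
    modelPhi p l (modelQ p l x) = x := by
  rw [modelQ, modelPhi, Matrix.mulVecLin_apply, Matrix.mulVecLin_apply, Matrix.mulVec_mulVec,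
    Matrix.nonsing_inv_mul _ (isUnit_det_modelQ hl), Matrix.one_mulVec]

theorem bijective_modelPhi [Fact p.Prime] {l : ZMod p} (hl : l ≠ 0) :
    Function.Bijective (modelPhi p l) :=
  ⟨Function.LeftInverse.injective (modelQ_modelPhi hl),
    Function.RightInverse.surjective (modelPhi_modelQ hl)⟩

theorem modelP_modelQ [Fact p.Prime] (l m : ZMod p) (x : Fin p → ZMod p) :
    modelP p m (modelQ p l x) = modelQ p l (modelP p m x) + x := by
  have := LinearMap.congr_fun (modelP_mul_modelQ_sub l m) x
  rw [← sub_eq_iff_eq_add']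
  simpa using this

theorem modelPhi_relation [Fact p.Prime] {l : ZMod p} (hl : l ≠ 0) (m : ZMod p)
    (x : Fin p → ZMod p) :
    modelPhi p l (modelPhi p l x) + modelP p m (modelPhi p l x) =
      modelPhi p l (modelP p m x) := by
  apply (bijective_modelQ hl).1
  rw [map_add, modelQ_modelPhi hl, modelQ_modelPhi hl, add_comm, ← modelP_modelQ,
    modelQ_modelPhi hl]

theorem isAffineSimpleLatinCycleSet_modelOp [Fact p.Prime] {l m : ZMod p} (hl : l ≠ 0)
    (hm : m ≠ 0) (c : Fin p → ZMod p) : IsAffineSimpleLatinCycleSet (modelOp p l m c) :=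
  isAffineSimpleLatinCycleSet_affOp (p := p) (by simp)
    (φ := (modelPhi p l).toAddMonoidHom) (ψ := (modelP p m).toAddMonoidHom)
    (bijective_modelPhi hl) (bijective_modelP hm) (modelPhi_relation hl m) c

/-- Translation by `a` changes the constant by the image of `a` under `1 - φ - ψ`. -/
noncomputable def modelShift (p : ℕ) (l m : ZMod p) : Module.End (ZMod p) (Fin p → ZMod p) :=
  1 - modelPhi p l - modelP p m

theorem modelShift_apply (l m : ZMod p) (x : Fin p → ZMod p) :
    modelShift p l m x = x - modelPhi p l x - modelP p m x := rfl

/-- If `w = φ w + ψ w`, then `φ⁻¹ w` is fixed by `ψ`. -/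
theorem modelP_modelQ_of_modelShift_eq_zero [Fact p.Prime] {l m : ZMod p} (hl : l ≠ 0)
    {w : Fin p → ZMod p} (hw : modelShift p l m w = 0) :
    modelP p m (modelQ p l w) = modelQ p l w := by
  rw [modelShift_apply, sub_eq_zero] at hw
  rw [modelP_modelQ, ← hw, map_sub, modelQ_modelPhi hl, sub_add_cancel]

theorem surjective_modelShift [Fact p.Prime] {l m : ZMod p} (hl : l ≠ 0) (hm : m ≠ 1) :
    Function.Surjective (modelShift p l m) := by
  rw [← LinearMap.injective_iff_surjective, injective_iff_map_eq_zero]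
  intro w hw
  have h1 := modelP_modelQ_of_modelShift_eq_zero hl hw
  have h2 : (modelP p m ^ p) (modelQ p l w) = modelQ p l w := by
    rw [Module.End.coe_pow]
    exact Function.iterate_fixed h1 p
  rw [modelP_pow] at h2
  have h3 : (m - 1) • modelQ p l w = 0 := by
    rw [sub_smul, one_smul, sub_eq_zero]
    simpa using h2
  apply (bijective_modelQ hl).1
  rw [map_zero]
  exact (smul_eq_zero.1 h3).resolve_left (sub_ne_zero.2 hm)

/-- The functional `x ↦ ∑ i, (i - λ) x_i`. For `μ = 1`, the model is `𝔽_p[t] / (t - 1) ^ p` with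
`ψ` the multiplication by `t` and `φ⁻¹ = λ - d/dt`, and the functional is `f ↦ f'(1) - λ f(1)`. -/
def shiftFunctional (p : ℕ) (l : ZMod p) : (Fin p → ZMod p) →ₗ[ZMod p] ZMod p :=
  stdLift (ZMod p) p fun i => (i : ZMod p) - l

theorem shiftFunctional_stdVec (l : ZMod p) {k : ℕ} (hk : k < p) :
    shiftFunctional p l (stdVec (ZMod p) p k) = (k : ZMod p) - l :=
  stdLift_stdVec _ hk

theorem shiftFunctional_modelP (l : ZMod p) (x : Fin p → ZMod p) :
    shiftFunctional p l (modelP p 1 x) =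
      shiftFunctional p l x + stdLift (ZMod p) p (fun _ => (1 : ZMod p)) x := by
  have : shiftFunctional p l ∘ₗ modelP p 1 =
      shiftFunctional p l + stdLift (ZMod p) p (fun _ => (1 : ZMod p)) := by
    apply linearMap_ext_stdVec
    intro k hk
    rw [LinearMap.comp_apply, LinearMap.add_apply, stdLift_stdVec _ hk,
      shiftFunctional_stdVec l hk]
    rcases Nat.lt_or_ge (k + 1) p with hk' | hk'
    · rw [modelP_stdVec 1 hk', shiftFunctional_stdVec l hk']
      push_cast
      ring
    · have hkp : k + 1 = p := by omega
      have h1 : ((k + 1 : ℕ) : ZMod p) = 0 := by rw [hkp]; simp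
      push_cast at h1
      rw [modelP_stdVec_last 1 hkp, one_smul, shiftFunctional_stdVec l (by omega)]
      push_cast
      linear_combination -h1
  exact LinearMap.congr_fun this x

theorem stdLift_one_modelQ (l : ZMod p) (x : Fin p → ZMod p) :
    stdLift (ZMod p) p (fun _ => (1 : ZMod p)) (modelQ p l x) = -shiftFunctional p l x := by
  have : stdLift (ZMod p) p (fun _ => (1 : ZMod p)) ∘ₗ modelQ p l = -shiftFunctional p l := by
    apply linearMap_ext_stdVec
    intro k hk
    rw [LinearMap.comp_apply, LinearMap.neg_apply, shiftFunctional_stdVec l hk]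
    cases k with
    | zero => rw [modelQ_stdVec_zero, map_smul, stdLift_stdVec _ hk]; simp
    | succ k =>
      rw [modelQ_stdVec_succ l (by omega), map_sub, map_smul, map_smul, stdLift_stdVec _ hk,
        stdLift_stdVec _ (by omega)]
      simp
  exact LinearMap.congr_fun this x

theorem shiftFunctional_modelShift [Fact p.Prime] {l : ZMod p} (hl : l ≠ 0)
    (x : Fin p → ZMod p) : shiftFunctional p l (modelShift p l 1 x) = 0 := by
  have h1 := stdLift_one_modelQ l (modelPhi p l x)
  rw [modelQ_modelPhi hl] at h1
  rw [modelShift_apply, map_sub, map_sub, shiftFunctional_modelP, h1]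
  ring

theorem modelP_apply_succ (m : ZMod p) (x : Fin p → ZMod p) {i : ℕ} (hi : i + 1 < p) :
    modelP p m x ⟨i + 1, hi⟩ = x ⟨i, by omega⟩ := by
  have : LinearMap.proj (⟨i + 1, hi⟩ : Fin p) ∘ₗ modelP p m =
      LinearMap.proj (⟨i, by omega⟩ : Fin p) := by
    apply linearMap_ext_stdVec
    intro k hk
    rw [LinearMap.comp_apply, LinearMap.proj_apply, LinearMap.proj_apply]
    rcases Nat.lt_or_ge (k + 1) p with hk' | hk'
    · rw [modelP_stdVec m hk']
      simp [stdVec]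
    · rw [modelP_stdVec_last m (by omega)]
      have : i ≠ k := by omega
      simp [stdVec, this]
  exact LinearMap.congr_fun this x

theorem exists_eq_smul_of_modelP_eq_self [Fact p.Prime] {m : ZMod p} {x : Fin p → ZMod p}
    (hx : modelP p m x = x) : ∃ a : ZMod p, x = a • fun _ => (1 : ZMod p) := by
  have hp := (Fact.out : p.Prime).pos
  refine ⟨x ⟨0, hp⟩, ?_⟩
  have : ∀ (i : ℕ) (hi : i < p), x ⟨i, hi⟩ = x ⟨0, hp⟩ := by
    intro i
    induction i with
    | zero => intro _; rfl
    | succ i ih =>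
      intro hi
      rw [← ih (by omega), ← modelP_apply_succ m x hi, hx]
  ext i
  simp [this i i.2]

/-- The kernel of `1 - φ - ψ` has dimension at most one, so its image is the whole kernel of the
functional. -/
theorem range_modelShift_one [Fact p.Prime] {l : ZMod p} (hl : l ≠ 0) :
    LinearMap.range (modelShift p l 1) = LinearMap.ker (shiftFunctional p l) := by
  have hp := (Fact.out : p.Prime).pos
  have hle : LinearMap.range (modelShift p l 1) ≤ LinearMap.ker (shiftFunctional p l) := by
    rintro _ ⟨x, rfl⟩
    exact shiftFunctional_modelShift hl x
  have hker : LinearMap.ker (modelShift p l 1) ≤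
      Submodule.span (ZMod p) {modelPhi p l fun _ => (1 : ZMod p)} := by
    intro w hw
    obtain ⟨a, ha⟩ := exists_eq_smul_of_modelP_eq_self
      (modelP_modelQ_of_modelShift_eq_zero hl (LinearMap.mem_ker.1 hw))
    rw [Submodule.mem_span_singleton]
    exact ⟨a, by rw [← map_smul, ← ha, modelPhi_modelQ hl]⟩
  have h1 : Module.finrank (ZMod p) (LinearMap.ker (modelShift p l 1)) ≤ 1 :=
    (Submodule.finrank_mono hker).trans ((finrank_span_le_card _).trans (by simp))
  have h2 := LinearMap.finrank_range_add_finrank_ker (modelShift p l 1)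
  have h3 : LinearMap.ker (shiftFunctional p l) ≠ ⊤ := by
    intro h
    have : stdVec (ZMod p) p 0 ∈ LinearMap.ker (shiftFunctional p l) := h ▸ Submodule.mem_top
    rw [LinearMap.mem_ker, shiftFunctional_stdVec l hp] at this
    exact hl (by simpa using this)
  have h4 := Submodule.finrank_lt h3
  exact Submodule.eq_of_le_of_finrank_le hle (by omega)

/-- Changing the constant of a model by a translation and a homothety. -/
theorem isomorphic_modelOp_of_eq [Fact p.Prime] {l m s : ZMod p} (hs : s ≠ 0)
    {c c' y : Fin p → ZMod p} (hc : c = modelShift p l m y + s • c') :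
    Isomorphic (modelOp p l m c) (modelOp p l m c') := by
  refine isomorphic_affOp_of_equiv
    (LinearEquiv.smulOfNeZero (ZMod p) (Fin p → ZMod p) s⁻¹ (inv_ne_zero hs)).toAddEquiv
    (-(s⁻¹ • y)) (fun x => ?_) (fun x => ?_) ?_
  · exact ((modelPhi p l).map_smul s⁻¹ x).symm
  · exact ((modelP p m).map_smul s⁻¹ x).symm
  · change s⁻¹ • c + -(s⁻¹ • y) =
      modelPhi p l (-(s⁻¹ • y)) + modelP p m (-(s⁻¹ • y)) + c'
    rw [hc, modelShift_apply, smul_add, smul_smul, inv_mul_cancel₀ hs, map_neg, map_neg,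
      map_smul, map_smul]
    module

theorem isomorphic_modelOp [Fact p.Prime] {l : ZMod p} (hl : l ≠ 0) (m : ZMod p)
    (c : Fin p → ZMod p) :
    Isomorphic (modelOp p l m c) (modelOp p l m 0) ∨
      m = 1 ∧ Isomorphic (modelOp p l m c) (modelOp p l 1 (firstVec (ZMod p) p)) := by
  have hp := (Fact.out : p.Prime).pos
  by_cases hm : m = 1
  · subst hm
    -- Subtracting a multiple of the first basis vector moves `c` into the image of `1 - φ - ψ`.
    let s := -(l⁻¹ * shiftFunctional p l c)
    have hmem : c - s • stdVec (ZMod p) p 0 ∈ LinearMap.range (modelShift p l 1) := by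
      rw [range_modelShift_one hl, LinearMap.mem_ker, map_sub, map_smul,
        shiftFunctional_stdVec l hp]
      simp only [s, Nat.cast_zero, smul_eq_mul]
      field_simp
      ring
    obtain ⟨y, hy⟩ := hmem
    have hc : c = modelShift p l 1 y + s • stdVec (ZMod p) p 0 := by rw [hy, sub_add_cancel]
    by_cases hs : s = 0
    · left
      refine isomorphic_modelOp_of_eq one_ne_zero (y := y) ?_
      rw [hc, hs]
      simp
    · exact Or.inr ⟨rfl, isomorphic_modelOp_of_eq hs hc⟩
  · left
    obtain ⟨y, hy⟩ := surjective_modelShift hl hm c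
    exact isomorphic_modelOp_of_eq one_ne_zero (y := y) (by simp [hy])

end ModelConstants

/-! ### Isomorphisms with and between models -/

section Isomorphisms

variable {p : ℕ} [Fact p.Prime]

theorem eq_of_intertwining_pow {V V' : Type*} [AddCommGroup V] [AddCommGroup V']
    [Module (ZMod p) V] [Module (ZMod p) V'] [Nontrivial V] {A : Module.End (ZMod p) V}
    {A' : Module.End (ZMod p) V'} (T : V ≃+ V') (hT : ∀ x, T (A x) = A' (T x)) {n : ℕ}
    {a a' : ZMod p} (hA : A ^ n = a • 1) (hA' : A' ^ n = a' • 1) : a = a' := by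
  obtain ⟨v, hv⟩ := exists_ne (0 : V)
  have hn : T ((A ^ n) v) = (A' ^ n) (T v) := by
    rw [Module.End.coe_pow, Module.End.coe_pow]
    exact Function.Semiconj.iterate_right (f := T) (show Function.Semiconj T A A' from hT) n v
  rw [hA, hA'] at hn
  have h1 : a • T v = a' • T v := by
    simpa [ZMod.map_smul] using hn
  exact smul_left_injective (ZMod p) (T.map_ne_zero_iff.2 hv) h1

theorem eq_of_isomorphic_modelOp {l m l' m' : ZMod p} {c c' : Fin p → ZMod p} (hl : l ≠ 0)
    (hm : m ≠ 0) (hl' : l' ≠ 0) (h : Isomorphic (modelOp p l m c) (modelOp p l' m' c')) :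
    l = l' ∧ m = m' := by
  have : Nonempty (Fin p) := ⟨⟨0, (Fact.out : p.Prime).pos⟩⟩
  rw [modelOp_eq, modelOp_eq] at h
  obtain ⟨T, hφ, hψ⟩ := h.exists_addEquiv (bijective_modelPhi hl).2 (bijective_modelP hm).2
  have hφ' : ∀ x, T (modelPhi p l x) = modelPhi p l' (T x) := hφ
  refine ⟨eq_of_intertwining_pow T (fun x => ?_) (modelQ_pow l) (modelQ_pow l'),
    eq_of_intertwining_pow T hψ (modelP_pow m) (modelP_pow m')⟩
  apply (bijective_modelPhi hl').1
  rw [← hφ', modelPhi_modelQ hl, modelPhi_modelQ hl']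

/-- The model with constant `0` has the idempotent `0`, whereas an idempotent of the model with
constant `(1, 0, …, 0)` would put this constant into the image of `1 - φ - ψ`. -/
theorem not_isomorphic_modelOp_firstVec {l l' m : ZMod p} (hl' : l' ≠ 0) :
    ¬ Isomorphic (modelOp p l m 0) (modelOp p l' 1 (firstVec (ZMod p) p)) := by
  rintro ⟨f, hf⟩
  have h0 : modelOp p l m 0 0 0 = 0 := by simp [modelOp_eq, affOp]
  have h1 := hf 0 0
  rw [h0] at h1
  have h2 : f 0 = modelPhi p l' (f 0) + modelP p 1 (f 0) + stdVec (ZMod p) p 0 := h1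
  have h3 : modelShift p l' 1 (f 0) = stdVec (ZMod p) p 0 := by
    rw [modelShift_apply]
    nth_rw 1 [h2]
    abel
  have h4 := shiftFunctional_modelShift hl' (f 0)
  rw [h3, shiftFunctional_stdVec l' (Fact.out : p.Prime).pos] at h4
  exact hl' (by simpa using h4)

theorem exists_isomorphic_modelOp_affOp {G : Type u} [AddCommGroup G] [Module (ZMod p) G]
    [FiniteDimensional (ZMod p) G] (hG : Module.finrank (ZMod p) G = p) {φ : G →+ G} {ψ : G ≃+ G}
    {c : G} (hcs : IsCycleSet (affOp φ ψ.toAddMonoidHom c))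
    (hlat : IsLatin (affOp φ ψ.toAddMonoidHom c)) :
    ∃ (l m : ZMod p) (d : Fin p → ZMod p), l ≠ 0 ∧ m ≠ 0 ∧
      Isomorphic (affOp φ ψ.toAddMonoidHom c) (modelOp p l m d) := by
  have hp := (Fact.out : p.Prime)
  let e := LinearEquiv.ofBijective (φ.toZModLinearMap p) (bijective_of_isLatin_affOp hlat)
  let P : Module.End (ZMod p) G := ψ.toAddMonoidHom.toZModLinearMap p
  have hPQ := commutator_eq_one_of_relation e P (relation_of_cycle hcs.cycle)
  obtain ⟨l, m, S, hSP, hSQ⟩ := exists_equiv_model hG hPQ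
  have hl : l ≠ 0 := by
    rintro rfl
    have h1 := hSQ (stdVec (ZMod p) p 0)
    rw [modelQ_stdVec_zero, zero_smul, map_zero] at h1
    have h2 : S (stdVec (ZMod p) p 0) = 0 := e.symm.map_eq_zero_iff.1 h1.symm
    exact stdVec_ne_zero hp.pos (S.map_eq_zero_iff.1 h2)
  have hm : m ≠ 0 := by
    rintro rfl
    have h1 := hSP (stdVec (ZMod p) p (p - 1))
    rw [modelP_stdVec_last 0 (Nat.sub_add_cancel hp.pos), zero_smul, map_zero] at h1
    have h2 : S (stdVec (ZMod p) p (p - 1)) = 0 := ψ.map_eq_zero_iff.1 h1.symm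
    exact stdVec_ne_zero (Nat.sub_lt hp.pos one_pos) (S.map_eq_zero_iff.1 h2)
  refine ⟨l, m, S.symm c, hl, hm, ?_⟩
  refine isomorphic_affOp_of_equiv S.symm.toAddEquiv 0 (fun x => ?_) (fun x => ?_) (by simp)
  · change S.symm (e x) = modelPhi p l (S.symm x)
    apply (bijective_modelQ hl).1
    rw [modelQ_modelPhi hl]
    apply S.injective
    rw [hSQ, S.apply_symm_apply, S.apply_symm_apply]
    exact e.symm_apply_apply x
  · change S.symm (P x) = modelP p m (S.symm x)
    apply S.injective
    rw [hSP, S.apply_symm_apply, S.apply_symm_apply]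

theorem exists_isomorphic_modelOp {X : Type u} {op : X → X → X}
    (h : IsAffineSimpleLatinCycleSet op) (hX : Nat.card X = p ^ p) :
    ∃ (l m : ZMod p) (c : Fin p → ZMod p), l ≠ 0 ∧ m ≠ 0 ∧
      Isomorphic op (modelOp p l m c) := by
  have hp := (Fact.out : p.Prime)
  obtain ⟨hcs, hlat, hsim, _, φ, ψ, c, rfl⟩ := h
  have : Finite X := Nat.finite_of_card_ne_zero (hX ▸ pow_ne_zero p hp.ne_zero)
  have : Module (ZMod p) X :=
    AddCommGroup.zmodModule (hsim.nsmul_eq_zero (p := p) (k := p) ψ.bijective hX)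
  have hrank : Module.finrank (ZMod p) X = p := by
    have h1 := Module.natCard_eq_pow_finrank (K := ZMod p) (V := X)
    rw [hX, Nat.card_zmod] at h1
    exact (Nat.pow_right_injective hp.two_le h1).symm
  exact exists_isomorphic_modelOp_affOp hrank hcs hlat

end Isomorphisms

/-! ### Isomorphism classes -/

section Counting

variable {p : ℕ} [Fact p.Prime]

theorem exists_isomorphic_affineSimpleLatinCycleSet {l m : ZMod p} (hl : l ≠ 0) (hm : m ≠ 0)
    (c : Fin p → ZMod p) :
    ∃ A : AffineSimpleLatinCycleSet.{u} (p ^ p), Isomorphic A.op (modelOp p l m c) := by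
  let e : ULift.{u} (Fin p → ZMod p) ≃ₗ[ZMod p] (Fin p → ZMod p) := ULift.moduleEquiv
  let φ : ULift.{u} (Fin p → ZMod p) →+ ULift.{u} (Fin p → ZMod p) :=
    (e.symm.conj (modelPhi p l)).toAddMonoidHom
  let ψ : ULift.{u} (Fin p → ZMod p) →+ ULift.{u} (Fin p → ZMod p) :=
    (e.symm.conj (modelP p m)).toAddMonoidHom
  have hφ : ∀ x, φ x = e.symm (modelPhi p l (e x)) := fun _ => rfl
  have hψ : ∀ x, ψ x = e.symm (modelP p m (e x)) := fun _ => rfl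
  refine ⟨⟨ULift.{u} (Fin p → ZMod p), affOp φ ψ (e.symm c),
    isAffineSimpleLatinCycleSet_affOp (p := p) ?_ ?_ ?_ ?_ _, ?_⟩, ?_⟩
  · rw [e.finrank_eq]
    simp
  · exact e.symm.bijective.comp ((bijective_modelPhi hl).comp e.bijective)
  · exact e.symm.bijective.comp ((bijective_modelP hm).comp e.bijective)
  · intro x
    simp only [hφ, hψ, e.apply_symm_apply, ← map_add, modelPhi_relation hl]
  · simp
  · refine isomorphic_affOp_of_equiv e.toAddEquiv 0 (fun x => ?_) (fun x => ?_) ?_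
    · exact e.apply_symm_apply _
    · exact e.apply_symm_apply _
    · change e (e.symm c) + 0 = _
      simp

/-- The index of a model: `λ`, and `μ` if the constant is `0`; in the remaining case `μ = 1` and
the constant is `(1, 0, …, 0)`. -/
abbrev ModelIndex (p : ℕ) : Type := (ZMod p)ˣ × Option (ZMod p)ˣ

/-- The operation of the model with the given index. -/
noncomputable def ModelIndex.op :
    ModelIndex p → (Fin p → ZMod p) → (Fin p → ZMod p) → (Fin p → ZMod p)
  | (l, some m) => modelOp p l m 0
  | (l, none) => modelOp p l 1 (firstVec (ZMod p) p)

theorem ModelIndex.exists_isomorphic (i : ModelIndex p) :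
    ∃ A : AffineSimpleLatinCycleSet.{u} (p ^ p), Isomorphic A.op i.op := by
  obtain ⟨l, _ | m⟩ := i
  · exact exists_isomorphic_affineSimpleLatinCycleSet l.ne_zero one_ne_zero _
  · exact exists_isomorphic_affineSimpleLatinCycleSet l.ne_zero m.ne_zero _

theorem ModelIndex.eq_of_isomorphic {i j : ModelIndex p} (h : Isomorphic i.op j.op) : i = j := by
  obtain ⟨l, _ | m⟩ := i <;> obtain ⟨l', _ | m'⟩ := j
  · have := eq_of_isomorphic_modelOp l.ne_zero one_ne_zero l'.ne_zero h
    rw [Units.ext this.1]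
  · exact absurd h.symm (not_isomorphic_modelOp_firstVec l.ne_zero)
  · exact absurd h (not_isomorphic_modelOp_firstVec l'.ne_zero)
  · have := eq_of_isomorphic_modelOp l.ne_zero m.ne_zero l'.ne_zero h
    rw [Units.ext this.1, Units.ext this.2]

theorem exists_isomorphic_modelIndex_op {X : Type u} {op : X → X → X}
    (h : IsAffineSimpleLatinCycleSet op) (hX : Nat.card X = p ^ p) :
    ∃ i : ModelIndex p, Isomorphic op i.op := by
  obtain ⟨l, m, c, hl, hm, hiso⟩ := exists_isomorphic_modelOp h hX
  rcases isomorphic_modelOp hl m c with h0 | ⟨_, h1⟩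
  · exact ⟨(Units.mk0 l hl, some (Units.mk0 m hm)), hiso.trans h0⟩
  · exact ⟨(Units.mk0 l hl, none), hiso.trans h1⟩

theorem card_modelIndex : Nat.card (ModelIndex p) = p * (p - 1) := by
  rw [Nat.card_eq_fintype_card, Fintype.card_prod, Fintype.card_option, ZMod.card_units,
    Nat.sub_add_cancel (Fact.out : p.Prime).pos, mul_comm]

theorem card_quotient_isoSetoid :
    Nat.card (Quotient (isoSetoid.{u} (p ^ p))) = p * (p - 1) := by
  choose A hA using fun i : ModelIndex p => i.exists_isomorphic.{u}
  rw [← card_modelIndex (p := p)]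
  refine (Nat.card_eq_of_bijective
    (fun i => (Quotient.mk (isoSetoid.{u} (p ^ p)) (A i))) ⟨fun i j hij => ?_, ?_⟩).symm
  · have h1 : Isomorphic (A i).op (A j).op := Quotient.exact hij
    exact ModelIndex.eq_of_isomorphic (((hA i).symm.trans h1).trans (hA j))
  · intro q
    induction q using Quotient.inductionOn with
    | h B =>
      obtain ⟨i, hi⟩ := exists_isomorphic_modelIndex_op B.prop B.card_eq
      exact ⟨i, Quotient.sound ((hA i).trans hi.symm)⟩

end Counting

end CycleSets

theorem mainTheorem1 (p : ℕ) (hp : p.Prime) :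
    (∀ l μ : ZMod p, l ≠ 0 → μ ≠ 0 →
      CycleSets.IsAffineSimpleLatinCycleSet (CycleSets.modelOp p l μ 0)) ∧
    (∀ l : ZMod p, l ≠ 0 →
      CycleSets.IsAffineSimpleLatinCycleSet
        (CycleSets.modelOp p l 1 (CycleSets.firstVec (ZMod p) p))) ∧
    (∀ (X : Type u) (op : X → X → X),
      CycleSets.IsAffineSimpleLatinCycleSet op → Nat.card X = p ^ p →
        (∃ l μ : ZMod p, l ≠ 0 ∧ μ ≠ 0 ∧
          CycleSets.Isomorphic op (CycleSets.modelOp p l μ 0)) ∨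
        (∃ l : ZMod p, l ≠ 0 ∧
          CycleSets.Isomorphic op
            (CycleSets.modelOp p l 1 (CycleSets.firstVec (ZMod p) p)))) ∧
    Nat.card (Quotient (CycleSets.isoSetoid.{u} (p ^ p))) = p * (p - 1) := by
  have : Fact p.Prime := ⟨hp⟩
  refine ⟨fun l μ hl hμ => CycleSets.isAffineSimpleLatinCycleSet_modelOp hl hμ 0,
    fun l hl => CycleSets.isAffineSimpleLatinCycleSet_modelOp hl one_ne_zero _,
    fun X op h hX => ?_, CycleSets.card_quotient_isoSetoid⟩
  obtain ⟨⟨l, _ | m⟩, hi⟩ := CycleSets.exists_isomorphic_modelIndex_op h hX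
  · exact Or.inr ⟨l, l.ne_zero, hi⟩
  · exact Or.inl ⟨l, m, l.ne_zero, m.ne_zero, hi⟩
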